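/- Let $(X,\mu)$ be a standard probability space, i.e. a standard Borel space with a non-atomic Borel probability measure, and let $T$ be a measure-preserving Borel bijection of $X$. All statements about sets and maps are up to measure zero. The $\mathrm L^1$ full group $[T]_1$ consists of the measure-preserving Borel bijections $U$ of $X$ for which there is an integrable $c_U:X\to\mathbb Z$ with $U(x)=T^{c_U(x)}(x)$ for almost every $x$. The support of $U$ is $\{x: U(x)\neq x\}$, and $U$ is an $n$-cycle if almost every $U$-orbit has cardinality $1$ or $n$. For a Borel set $A$, the induced transformation $T_A$ is the identity outside $A$, and $T_A(x)=T^{k}(x)$ for almost every $x\in A$, where $k\geq 1$ is least with $T^k(x)\in A$. (1) Suppose that $T$ is ergodic, let $A\subseteq X$ be Borel and let $n\geq 2$. Then $A$ is the support of an $n$-cycle belonging to $[T]_1$ if and only if there is a Borel set $B\subseteq A$ such that $$A=B\sqcup T_A(B)\sqcup\cdots\sqcup T_A^{n-1}(B).$$ (2) If $T$ is weakly mixing, i.e. $\frac1N\sum_{k=0}^{N-1}|\mu(T^{-k}A\cap B)-\mu(A)\mu(B)|\to 0$ for all Borel $A,B\subseteq X$, then for every $n\in\mathbb N$ there is no $n$-cycle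 in $[T]_1$ whose support is $X$. -/

import Mathlib

open MeasureTheory Filter Topology

namespace L1FullGroup

variable {X : Type*} [MeasurableSpace X]

/-- The `k`-th iterate `T ^ k` (`k` an integer, possibly negative) of a Borel bijection `T`,
as a permutation of the space. -/
def iter (T : X ≃ᵐ X) (k : ℤ) : Equiv.Perm X := (T.toEquiv : Equiv.Perm X) ^ k

/-- `c` is a cocycle of `U` with respect to `T`: `U x = T ^ (c x) x` for almost every `x`.
When almost all `T`-orbits are infinite, such a `c` is unique up to measure zero. -/
def IsCocycle (μ : Measure X) (T U : X ≃ᵐ X) (c : X → ℤ) : Prop :=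
  ∀ᵐ x ∂μ, U x = iter T (c x) x

/-- The `L¹` full group `[T]₁`: the measure-preserving Borel bijections `U` that map almost every
point into its own `T`-orbit and whose cocycle is integrable. Elements of `Aut(X, μ)` are
represented by Borel bijections, and all conditions are invariant under a.e. equality. -/
def fullGroupL1 (μ : Measure X) (T : X ≃ᵐ X) : Set (X ≃ᵐ X) :=
  {U | MeasurePreserving U μ μ ∧
    ∃ c : X → ℤ, IsCocycle μ T U c ∧ Integrable (fun x => (c x : ℝ)) μ}

/-- The support of `U`: the set of points that `U` moves. -/
def support (U : X ≃ᵐ X) : Set X := {x | U x ≠ x}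

/-- The orbit of `x` under the group generated by `U`. -/
def orbit (U : X ≃ᵐ X) (x : X) : Set X := Set.range fun k : ℤ => iter U k x

/-- `U` is an `n`-cycle: (almost) every orbit of `U` has cardinality `1` or `n`. -/
def IsNCycle (μ : Measure X) (U : X ≃ᵐ X) (n : ℕ) : Prop :=
  ∀ᵐ x ∂μ, (orbit U x).encard = 1 ∨ (orbit U x).encard = (n : ℕ∞)

/-- The return time to `A`: the least `n ≥ 1` with `T ^ n x ∈ A`. It is `0` if there is no such
`n`, which for a measure-preserving `T` concerns only a null set of points of `A`. -/
noncomputable def returnTime (T : X ≃ᵐ X) (A : Set X) (x : X) : ℕ :=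
  sInf {n : ℕ | 1 ≤ n ∧ T^[n] x ∈ A}

open Classical in
/-- The transformation `T_A` induced by `T` on `A`: the first return map on `A`, extended by the
identity outside `A`. -/
noncomputable def induced (T : X ≃ᵐ X) (A : Set X) (x : X) : X :=
  if x ∈ A then T^[returnTime T A x] x else x

/-- `A = B ⊔ T_A(B) ⊔ ⋯ ⊔ T_A^{n-1}(B)` for some Borel `B ⊆ A`, where disjointness and equality of
Borel sets are understood up to measure zero. -/
def SplitsAlongInduced (μ : Measure X) (T : X ≃ᵐ X) (A : Set X) (n : ℕ) : Prop :=
  ∃ B : Set X, MeasurableSet B ∧ B ⊆ A ∧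
    (∀ i < n, ∀ j < n, i ≠ j →
      AEDisjoint μ ((induced T A)^[i] '' B) ((induced T A)^[j] '' B)) ∧
    A =ᵐ[μ] ⋃ i < n, (induced T A)^[i] '' B

/-- `T` is weakly mixing: for all Borel sets `A`, `B` the averages
`(1/N) ∑_{k < N} |μ(T⁻ᵏ A ∩ B) - μ(A) μ(B)|` tend to zero. -/
def IsWeaklyMixing (μ : Measure X) (T : X ≃ᵐ X) : Prop :=
  ∀ A B : Set X, MeasurableSet A → MeasurableSet B →
    Tendsto (fun N : ℕ => (N : ℝ)⁻¹ * ∑ k ∈ Finset.range N,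
      |μ.real ((T^[k]) ⁻¹' A ∩ B) - μ.real A * μ.real B|) atTop (𝓝 0)

end L1FullGroup

/-! Both parts rest on the equation `f ∘ T = f + 1_A` modulo `n`. Let `U` be an `n`-cycle in `[T]₁`
with support `A`. Ergodicity and the absence of atoms make almost every `T`-orbit a copy of `ℤ`,
partitioned within `A` into `U`-orbits of `n` points. Cut the line just before `x`, and let `f x`
count the points of `A` before the cut whose `U`-orbit continues beyond it. Borel–Cantelli and
integrability of the cocycle make this number finite. Moving the cut past a point of `A` raises it
by `1`, or lowers it by `n - 1` if that point is the last of its `U`-orbit; other points change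
nothing (`ncard_crossing_one`, `exists_measurable_comp_eq_add_indicator`). So `T_A` adds `1` to `f`
modulo `n`, and `B = A ∩ {f = 0}` is the base of the splitting. Conversely, Kac's estimate puts
`T_A` in `[T]₁` (`integrable_returnTime`). Sending the top level of the tower over `B` back to `B`
by `T_A^{-(n-1)}` closes it into an `n`-cycle (`exists_cycle_of_tower`). For `A = X` the equation
exhibits rotation on `ℤ / n` as a factor of `T`, which weak mixing excludes when `n ≥ 2`. -/

namespace L1FullGroup

/-! ### Integer iterates and invariant conull sets -/

section Iterates

variable {X : Type*} [MeasurableSpace X]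

@[simp] lemma iter_zero (T : X ≃ᵐ X) (x : X) : iter T 0 x = x := by simp [iter]

@[simp] lemma iter_one (T : X ≃ᵐ X) (x : X) : iter T 1 x = T x := by simp [iter]

lemma iter_add (T : X ≃ᵐ X) (k l : ℤ) (x : X) : iter T (k + l) x = iter T k (iter T l x) := by
  simp [iter, zpow_add]

lemma iter_natCast (T : X ≃ᵐ X) (k : ℕ) (x : X) : iter T (k : ℤ) x = T^[k] x := by
  simp only [iter, zpow_natCast, Equiv.Perm.coe_pow]
  rfl

lemma iter_neg_iter (T : X ≃ᵐ X) (k : ℤ) (x : X) : iter T (-k) (iter T k x) = x := by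
  rw [← iter_add]; simp

lemma iter_iter_neg (T : X ≃ᵐ X) (k : ℤ) (x : X) : iter T k (iter T (-k) x) = x := by
  rw [← iter_add]; simp

lemma iter_neg_one (T : X ≃ᵐ X) (x : X) : iter T (-1) x = T.symm x := by
  apply T.injective
  rw [← iter_one T (iter T (-1) x), iter_iter_neg]; simp

lemma iter_symm (T : X ≃ᵐ X) (k : ℤ) (x : X) : iter T.symm k x = iter T (-k) x := by
  have : (T.symm.toEquiv : Equiv.Perm X) = (T.toEquiv : Equiv.Perm X)⁻¹ := rfl
  simp [iter, this]

lemma iter_eq_self (T : X ≃ᵐ X) {x : X} (h : T x = x) (k : ℤ) : iter T k x = x :=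
  Equiv.Perm.zpow_apply_eq_self_of_apply_eq_self (f := T.toEquiv) h k

lemma iter_injective (T : X ≃ᵐ X) (k : ℤ) : Function.Injective (iter T k) := (iter T k).injective

lemma measurable_iter (T : X ≃ᵐ X) (k : ℤ) : Measurable (iter T k) := by
  obtain ⟨m, rfl | rfl⟩ := k.eq_nat_or_neg
  · have : (iter T m : X → X) = T^[m] := funext fun x => iter_natCast T m x
    rw [this]; exact T.measurable.iterate m
  · have : (iter T (-m) : X → X) = T.symm^[m] := funext fun x => by
      rw [← iter_symm, iter_natCast]
    rw [this]; exact T.symm.measurable.iterate m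

lemma measurePreserving_iter {μ : Measure X} {T : X ≃ᵐ X} (hT : MeasurePreserving T μ μ) (k : ℤ) :
    MeasurePreserving (iter T k) μ μ := by
  obtain ⟨m, rfl | rfl⟩ := k.eq_nat_or_neg
  · have : (iter T m : X → X) = T^[m] := funext fun x => iter_natCast T m x
    rw [this]; exact hT.iterate m
  · have : (iter T (-m) : X → X) = T.symm^[m] := funext fun x => by
      rw [← iter_symm, iter_natCast]
    rw [this]; exact (hT.symm T).iterate m

lemma mem_iter_iff_of_invariant {T : X ≃ᵐ X} {G : Set X} (hG : ∀ x, T x ∈ G ↔ x ∈ G) (k : ℤ)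
    (x : X) : iter T k x ∈ G ↔ x ∈ G := by
  induction k using Int.induction_on with
  | zero => simp
  | succ i ih => rw [add_comm, iter_add, iter_one, hG, ih]
  | pred i ih => rw [sub_eq_neg_add, iter_add, iter_neg_one, ← hG, T.apply_symm_apply, ih]

/-- An almost sure property holds on a measurable conull set invariant under a measure-preserving
bijection. -/
lemma exists_invariant_conull {μ : Measure X} {T : X ≃ᵐ X} (hT : MeasurePreserving T μ μ)
    {p : X → Prop} (hp : ∀ᵐ x ∂μ, p x) :
    ∃ G : Set X, MeasurableSet G ∧ (∀ x, T x ∈ G ↔ x ∈ G) ∧ (∀ᵐ x ∂μ, x ∈ G) ∧ ∀ x ∈ G, p x := by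
  obtain ⟨N, hpN, hN, hN0⟩ := exists_measurable_superset_of_null (ae_iff.1 hp)
  refine ⟨⋂ k : ℤ, iter T k ⁻¹' Nᶜ, .iInter fun k => measurable_iter T k hN.compl, fun x => ?_,
    ?_, fun x hx => ?_⟩
  · simp only [Set.mem_iInter, Set.mem_preimage]
    constructor
    · intro h k
      have := h (k - 1)
      rwa [← iter_one T x, ← iter_add, sub_add_cancel] at this
    · intro h k
      rw [← iter_one T x, ← iter_add]
      exact h _
  · simp only [Set.mem_iInter, ae_all_iff]
    intro k
    exact (measurePreserving_iter hT k).quasiMeasurePreserving.ae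
      (measure_eq_zero_iff_ae_notMem.1 hN0)
  · by_contra h
    exact Set.mem_iInter.1 hx 0 (by simpa using hpN h)

lemma ae_forall_iter {μ : Measure X} {T : X ≃ᵐ X} (hT : MeasurePreserving T μ μ)
    {p : X → Prop} (hp : ∀ᵐ x ∂μ, p x) : ∀ᵐ x ∂μ, ∀ k : ℤ, p (iter T k x) :=
  ae_all_iff.2 fun k => (measurePreserving_iter hT k).quasiMeasurePreserving.ae hp

end Iterates

/-! ### Aperiodicity of ergodic bijections -/

section Aperiodic

variable {X : Type*} [MeasurableSpace X] [StandardBorelSpace X]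

/-- Otherwise almost every point is fixed by `T^k`. The least real code along the orbit is then an
invariant function, hence constant, so almost every point lies in one finite set, which is null. -/
lemma ae_iterate_ne_self {μ : Measure X} [IsProbabilityMeasure μ]
    [NullSingletonClass μ] {T : X ≃ᵐ X} (hE : Ergodic T μ) {k : ℕ} (hk : 0 < k) :
    ∀ᵐ x ∂μ, T^[k] x ≠ x := by
  have hPm : MeasurableSet {x | T^[k] x = x} :=
    measurableSet_eq_fun (T.measurable.iterate k) measurable_id
  have hinv : T ⁻¹' {x | T^[k] x = x} = {x | T^[k] x = x} := by
    ext x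
    simp only [Set.mem_preimage, Set.mem_ofPred_eq, ← Function.iterate_succ_apply,
      Function.iterate_succ_apply', T.injective.eq_iff]
  refine (hE.toPreErgodic.ae_mem_or_ae_notMem hPm hinv).resolve_left fun hper => ?_
  have hne : (Finset.range k).Nonempty := ⟨0, by simpa using hk⟩
  let φ := embeddingReal X
  have hφ : MeasurableEmbedding φ := measurableEmbedding_embeddingReal X
  let g : X → ℝ := fun x => (Finset.range k).inf' hne fun i => φ (T^[i] x)
  have hg : Measurable g := by
    have : g = (Finset.range k).inf' hne fun i x => φ (T^[i] x) := by
      ext x; simp [g, Finset.inf'_apply]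
    rw [this]
    exact Finset.inf'_induction hne _ (fun _ h _ h' => h.inf h')
      fun i _ => hφ.measurable.comp (T.measurable.iterate i)
  have hgT : g ∘ T =ᵐ[μ] g := by
    filter_upwards [hper] with x hx
    apply le_antisymm
    · refine Finset.le_inf' hne _ fun i hi => ?_
      rcases Nat.eq_zero_or_pos i with rfl | h0
      -- By periodicity `x = T^[k - 1] (T x)`, so the index `0` for `x` becomes `k - 1` for `T x`.
      · refine (Finset.inf'_le _ (Finset.mem_range.2 (Nat.sub_lt hk one_pos))).trans_eq ?_
        rw [← Function.iterate_succ_apply, Nat.succ_eq_add_one,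
          show k - 1 + 1 = k by omega, hx]
        rfl
      · have hi' := Finset.mem_range.1 hi
        refine (Finset.inf'_le _ (Finset.mem_range.2 (show i - 1 < k by omega))).trans_eq ?_
        rw [← Function.iterate_succ_apply, Nat.succ_eq_add_one, show i - 1 + 1 = i by omega]
    · refine Finset.le_inf' hne _ fun i hi => ?_
      rw [← Function.iterate_succ_apply]
      have hi' := Finset.mem_range.1 hi
      rcases eq_or_ne (i + 1) k with h | h
      · rw [Nat.succ_eq_add_one, h, hx]
        exact Finset.inf'_le (fun i => φ (T^[i] x)) (Finset.mem_range.2 hk)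
      · exact Finset.inf'_le (fun i => φ (T^[i] x)) (Finset.mem_range.2 (by omega))
  obtain ⟨c, hc⟩ := hE.ae_eq_const_of_ae_eq_comp₀ hg.nullMeasurable hgT
  have hfin : Set.Finite (⋃ i ∈ Finset.range k, {x | φ (T^[i] x) = c}) := by
    refine (Finset.range k).finite_toSet.biUnion fun i _ => Set.Subsingleton.finite ?_
    intro x hx y hy
    exact T.injective.iterate i (hφ.injective (hx.trans (Eq.symm hy)))
  have hall : ∀ᵐ x ∂μ, x ∈ ⋃ i ∈ Finset.range k, {x | φ (T^[i] x) = c} := by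
    filter_upwards [hc] with x hx
    obtain ⟨i, hi, h⟩ := Finset.exists_mem_eq_inf' hne fun i => φ (T^[i] x)
    exact Set.mem_biUnion hi (h.symm.trans hx)
  have hnot := measure_eq_zero_iff_ae_notMem.1 (hfin.measure_zero μ)
  obtain ⟨x, hx, hx'⟩ := (hall.and hnot).exists
  exact hx' hx

/-- Almost all orbits of an ergodic bijection of an atomless probability space are infinite. -/
lemma ae_injective_iter {μ : Measure X} [IsProbabilityMeasure μ]
    [NullSingletonClass μ] {T : X ≃ᵐ X} (hE : Ergodic T μ) :
    ∀ᵐ x ∂μ, Function.Injective fun k : ℤ => iter T k x := by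
  have h : ∀ᵐ x ∂μ, ∀ k : ℕ, 0 < k → T^[k] x ≠ x :=
    ae_all_iff.2 fun k => by
      by_cases hk : 0 < k
      · filter_upwards [ae_iterate_ne_self hE hk] with x hx _ using hx
      · exact Eventually.of_forall fun x h => absurd h hk
  filter_upwards [h] with x hx
  have key : ∀ k l : ℤ, k < l → iter T k x ≠ iter T l x := fun k l hkl e => by
    refine hx (l - k).toNat (by omega) ?_
    rw [← iter_natCast, Int.toNat_of_nonneg (by omega)]
    apply iter_injective T k
    rw [← iter_add, e]; congr 2; ring
  intro k l e
  rcases lt_trichotomy k l with h | h | h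
  · exact absurd e (key k l h)
  · exact h
  · exact absurd e.symm (key l k h)

end Aperiodic

/-! ### Counting classes that cross a cut of `ℤ` -/

section Crossing

/-- The points `k < m` of `P` whose `r`-class contains some `l ≥ m`. -/
def crossing (r : ℤ → ℤ → Prop) (P : Set ℤ) (m : ℤ) : Set ℤ :=
  {k | k ∈ P ∧ k < m ∧ ∃ l, m ≤ l ∧ r k l}

open Classical in
/-- If all classes in `P` have `n` elements, then the number of points of `P` below `m`, taken
modulo `n` after removal of complete classes, increases by one when `m` passes a point of `P`. -/
lemma ncard_crossing_one {r : ℤ → ℤ → Prop} (hr : Equivalence r) {P : Set ℤ}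
    (hP : ∀ k l, r k l → (k ∈ P ↔ l ∈ P)) {n : ℕ} (hn : 0 < n)
    (hcard : ∀ k ∈ P, {l | r k l}.ncard = n)
    (h0 : (crossing r P 0).Finite) (h1 : (crossing r P 1).Finite) :
    (((crossing r P 1).ncard : ℕ) : ZMod n) =
      ((crossing r P 0).ncard : ZMod n) + if (0 : ℤ) ∈ P then 1 else 0 := by
  split_ifs with h
  · set O : Set ℤ := {l | r 0 l} with hO
    have hOfin : O.Finite := Set.finite_of_ncard_pos (by rw [hcard 0 h]; exact hn)
    have hOP : ∀ k ∈ O, k ∈ P := fun k hk => (hP 0 k hk).1 h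
    have h0O : (0 : ℤ) ∈ O := hr.refl 0
    -- Only the class `O` of `0` is affected when the cut moves past `0`.
    have hdiff : crossing r P 1 \ O = crossing r P 0 \ O := by
      ext k
      constructor
      · rintro ⟨⟨hkP, hk, l, hl, hkl⟩, hkO⟩
        refine ⟨⟨hkP, ?_, l, by omega, hkl⟩, hkO⟩
        have : k ≠ 0 := fun h => hkO (h ▸ h0O)
        omega
      · rintro ⟨⟨hkP, hk, l, hl, hkl⟩, hkO⟩
        refine ⟨⟨hkP, by omega, l, ?_, hkl⟩, hkO⟩
        have : l ≠ 0 := fun h => hkO (hr.symm (h ▸ hkl))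
        omega
    rw [← Set.ncard_inter_add_ncard_sdiff_eq_ncard _ O h1,
      ← Set.ncard_inter_add_ncard_sdiff_eq_ncard _ O h0, hdiff]
    have hmem : ∀ k, k ∈ crossing r P 0 ∩ O ↔ k < 0 ∧ k ∈ O := fun k =>
      ⟨fun hk => ⟨hk.1.2.1, hk.2⟩, fun hk => ⟨⟨hOP k hk.2, hk.1, 0, le_rfl, hr.symm hk.2⟩, hk.2⟩⟩
    have hnot : (0 : ℤ) ∉ crossing r P 0 ∩ O := fun hk => lt_irrefl _ ((hmem 0).1 hk).1
    have hfin : (crossing r P 0 ∩ O).Finite := hOfin.subset Set.inter_subset_right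
    -- Either `0` has a later classmate and joins the crossing points, or it is the last of its
    -- class and the other `n - 1` members leave.
    by_cases hpos : ∃ l, 1 ≤ l ∧ r 0 l
    · obtain ⟨l, hl, h0l⟩ := hpos
      have : crossing r P 1 ∩ O = insert 0 (crossing r P 0 ∩ O) := by
        ext k
        rw [Set.mem_insert_iff, hmem]
        constructor
        · rintro ⟨⟨_, hk, _⟩, hkO⟩
          rcases eq_or_ne k 0 with rfl | hk0
          · exact Or.inl rfl
          · exact Or.inr ⟨by omega, hkO⟩
        · rintro (rfl | ⟨hk, hkO⟩)
          · exact ⟨⟨h, by omega, l, hl, h0l⟩, h0O⟩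
          · exact ⟨⟨hOP k hkO, by omega, l, hl, hr.trans (hr.symm hkO) h0l⟩, hkO⟩
      rw [this, Set.ncard_insert_of_notMem hnot hfin]
      push_cast; ring
    · push Not at hpos
      have h1e : crossing r P 1 ∩ O = ∅ := by
        ext k
        simp only [Set.mem_inter_iff, Set.mem_empty_iff_false, iff_false]
        rintro ⟨⟨_, hk, l, hl, hkl⟩, hkO⟩
        exact hpos l hl (hr.trans hkO hkl)
      have hins : insert 0 (crossing r P 0 ∩ O) = O := by
        ext k
        rw [Set.mem_insert_iff, hmem]
        constructor
        · rintro (rfl | ⟨_, hk⟩)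
          exacts [h0O, hk]
        · intro hk
          rcases lt_trichotomy k 0 with h | h | h
          · exact Or.inr ⟨h, hk⟩
          · exact Or.inl h
          · exact absurd hk (hpos k (by omega))
      have hc : (crossing r P 0 ∩ O).ncard + 1 = n := by
        rw [← Set.ncard_insert_of_notMem hnot hfin, hins, hcard 0 h]
      have hz : (((crossing r P 0 ∩ O).ncard : ℕ) : ZMod n) + 1 = 0 := by
        rw [← ZMod.natCast_self n]; exact_mod_cast congrArg (Nat.cast : ℕ → ZMod n) hc
      rw [h1e, Set.ncard_empty]
      push_cast
      linear_combination -hz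
  · have : crossing r P 1 = crossing r P 0 := by
      ext k
      constructor
      · rintro ⟨hkP, hk, l, hl, hkl⟩
        refine ⟨hkP, ?_, l, by omega, hkl⟩
        have : k ≠ 0 := fun e => h (e ▸ hkP)
        omega
      · rintro ⟨hkP, hk, l, hl, hkl⟩
        refine ⟨hkP, by omega, l, ?_, hkl⟩
        have : l ≠ 0 := fun e => h (e ▸ (hP k l hkl).1 hkP)
        omega
    rw [this, add_zero]

end Crossing

/-! ### Finite orbits -/

section Orbits

variable {X : Type*} [MeasurableSpace X]

lemma mem_orbit_self (U : X ≃ᵐ X) (x : X) : x ∈ orbit U x := ⟨0, by simp⟩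

lemma orbit_symm {U : X ≃ᵐ X} {x y : X} (h : y ∈ orbit U x) : x ∈ orbit U y := by
  obtain ⟨j, rfl⟩ := h
  exact ⟨-j, iter_neg_iter U j x⟩

lemma orbit_trans {U : X ≃ᵐ X} {x y z : X} (h : y ∈ orbit U x) (h' : z ∈ orbit U y) :
    z ∈ orbit U x := by
  obtain ⟨j, rfl⟩ := h
  obtain ⟨i, rfl⟩ := h'
  exact ⟨i + j, iter_add U i j x⟩

lemma orbit_eq_of_mem {U : X ≃ᵐ X} {x y : X} (h : y ∈ orbit U x) : orbit U y = orbit U x :=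
  Set.Subset.antisymm (fun _ hz => orbit_trans h hz) fun _ hz => orbit_trans (orbit_symm h) hz

lemma orbit_eq_singleton {U : X ≃ᵐ X} {x : X} (h : U x = x) : orbit U x = {x} := by
  ext y
  constructor
  · rintro ⟨j, rfl⟩; exact iter_eq_self U h j
  · rintro rfl; exact mem_orbit_self U y

lemma apply_eq_self_of_encard_orbit_eq_one {U : X ≃ᵐ X} {x : X} (h : (orbit U x).encard = 1) :
    U x = x := by
  obtain ⟨y, hy⟩ := Set.encard_eq_one.1 h
  have h1 : x ∈ orbit U x := mem_orbit_self U x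
  have h2 : U x ∈ orbit U x := ⟨1, iter_one U x⟩
  rw [hy] at h1 h2
  rw [Set.mem_singleton_iff.1 h2, Set.mem_singleton_iff.1 h1]

lemma exists_iterate_eq_of_mem_orbit_of_iterate_eq {U : X ≃ᵐ X} {x y : X} {p : ℕ} (hp : 0 < p)
    (hx : U^[p] x = x) (h : y ∈ orbit U x) : ∃ i < p, U^[i] x = y := by
  obtain ⟨j, rfl⟩ := h
  have hp' : (0 : ℤ) < p := by exact_mod_cast hp
  have hj := Int.emod_nonneg j hp'.ne'
  refine ⟨(j % p).toNat, by have := Int.emod_lt_of_pos j hp'; omega, ?_⟩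
  rw [← iter_natCast, Int.toNat_of_nonneg hj]
  change _ = iter U j x
  conv_rhs => rw [← Int.emod_add_mul_ediv j p]
  have : iter U (p * (j / p)) x = x := by
    rw [iter, zpow_mul]
    exact Equiv.Perm.zpow_apply_eq_self_of_apply_eq_self
      (by have := iter_natCast U p x; rw [hx] at this; exact this) _
  rw [iter_add, this]

lemma exists_iterate_eq_self_of_encard_orbit {U : X ≃ᵐ X} {x : X} {n : ℕ}
    (h : (orbit U x).encard = n) : ∃ p, 0 < p ∧ p ≤ n ∧ U^[p] x = x := by
  have hfin : (orbit U x).Finite := Set.finite_of_encard_eq_coe h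
  have hn : (orbit U x).ncard = n := by rw [Set.ncard, h]; rfl
  obtain ⟨i, hi, j, hj, hij, e⟩ := Set.exists_ne_map_eq_of_ncard_lt_of_maps_to
    (s := (Finset.range (n + 1) : Set ℕ)) (t := orbit U x) (f := fun i => U^[i] x)
    (by rw [Set.ncard_coe_finset, hn]; simp) (fun i _ => ⟨i, iter_natCast U i x⟩) hfin
  have key : ∀ i j : ℕ, i < j → j < n + 1 → U^[i] x = U^[j] x →
      ∃ p, 0 < p ∧ p ≤ n ∧ U^[p] x = x := by
    intro i j hij hj e
    refine ⟨j - i, by omega, by omega, ?_⟩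
    apply U.injective.iterate i
    rw [← Function.iterate_add_apply, e]; congr 1; omega
  simp only [Finset.coe_range, Set.mem_Iio] at hi hj
  rcases lt_or_gt_of_ne hij with h | h
  · exact key i j h hj e
  · exact key j i h hi e.symm

/-- Fewer than `n` forward steps suffice, so displacements within a `U`-orbit are controlled by `n`
cocycle terms. -/
lemma exists_iterate_eq_of_mem_orbit {U : X ≃ᵐ X} {x y : X} {n : ℕ}
    (h : (orbit U x).encard = n) (hy : y ∈ orbit U x) : ∃ i < n, U^[i] x = y := by
  obtain ⟨p, hp, hpn, hx⟩ := exists_iterate_eq_self_of_encard_orbit h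
  obtain ⟨i, hi, e⟩ := exists_iterate_eq_of_mem_orbit_of_iterate_eq hp hx hy
  exact ⟨i, by omega, e⟩

end Orbits

/-! ### Cocycle sums and Borel–Cantelli -/

section FullGroup

variable {X : Type*} [MeasurableSpace X]

lemma iterate_eq_iter_sum {T U : X ≃ᵐ X} {c : X → ℤ} {x : X}
    (h : ∀ i : ℕ, U (U^[i] x) = iter T (c (U^[i] x)) (U^[i] x)) (m : ℕ) :
    U^[m] x = iter T (∑ i ∈ Finset.range m, c (U^[i] x)) x := by
  induction m with
  | zero => simp
  | succ m ih =>
    rw [Function.iterate_succ_apply', h, Finset.sum_range_succ, add_comm, iter_add, ← ih]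

/-- For integrable `D`, almost surely `D (T⁻ᵏ x) < k` for all but finitely many `k : ℕ`. -/
lemma ae_finite_le_comp_iter {μ : Measure X} [IsProbabilityMeasure μ] {T : X ≃ᵐ X}
    (hT : MeasurePreserving T μ μ) {D : X → ℝ} (hD : Integrable D μ) (hD0 : 0 ≤ D) :
    ∀ᵐ x ∂μ, {k : ℕ | (k : ℝ) ≤ D (iter T (-k) x)}.Finite := by
  have hs : (∑' k : ℕ, μ {x | (k : ℝ) ≤ D (iter T (-k) x)}) ≠ ⊤ := by
    -- By invariance the `k`-th term is `μ {k ≤ D}`. The available tail sum uses strict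
    -- inequalities, hence the shift to `D + 1`.
    have hD1 : Integrable (fun x => D x + 1) μ := hD.add (integrable_const 1)
    have := @ProbabilityTheory.tsum_prob_mem_Ioi_lt_top X ⟨μ⟩ ‹_› (fun x => D x + 1) hD1
      (fun x => add_nonneg (hD0 x) zero_le_one)
    refine ne_top_of_le_ne_top this.ne (ENNReal.tsum_le_tsum fun k => ?_)
    have hnull : NullMeasurableSet {x | (k : ℝ) ≤ D x} μ :=
      nullMeasurableSet_le aemeasurable_const hD.aemeasurable
    have e : μ {x | (k : ℝ) ≤ D (iter T (-k) x)} = μ {x | (k : ℝ) ≤ D x} :=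
      (measurePreserving_iter hT (-k)).measure_preimage hnull
    rw [e]
    refine measure_mono fun x hx => ?_
    have : (k : ℝ) ≤ D x := hx
    show (k : ℝ) < D x + 1
    linarith
  exact (ae_finite_setOfPred_mem hs)

end FullGroup

/-! ### The crossing number as a solution of the equation -/

section CrossingNumber

variable {X : Type*} [MeasurableSpace X]

/-- The crossing set of the partition of a `T`-orbit, identified with `ℤ`, into `U`-orbits. -/
def orbitCrossing (T U : X ≃ᵐ X) (A : Set X) (x : X) (m : ℤ) : Set ℤ :=
  crossing (fun k l => iter T l x ∈ orbit U (iter T k x)) {k | iter T k x ∈ A} m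

/-- Replacing `x` by `T x` amounts to moving the cut from `0` to `1`, up to a translation of `ℤ`. -/
lemma orbitCrossing_apply (T U : X ≃ᵐ X) (A : Set X) (x : X) :
    orbitCrossing T U A x 1 = (fun k => k + 1) '' orbitCrossing T U A (T x) 0 := by
  have e : ∀ k, iter T k (T x) = iter T (k + 1) x := fun k => by rw [iter_add, iter_one]
  ext k
  simp only [orbitCrossing, crossing, e, Set.mem_image]
  constructor
  · rintro ⟨hk, hk1, l, hl, hkl⟩
    refine ⟨k - 1, ⟨?_, by omega, l - 1, by omega, ?_⟩, by omega⟩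
    · simpa using hk
    · simpa using hkl
  · rintro ⟨k, ⟨hk, hk1, l, hl, hkl⟩, rfl⟩
    exact ⟨hk, by omega, l + 1, by omega, hkl⟩

lemma measurable_ncard_orbitCrossing [StandardBorelSpace X] (T U : X ≃ᵐ X) {A : Set X}
    (hA : MeasurableSet A) : Measurable fun x => (orbitCrossing T U A x 0).ncard := by
  refine measurable_ncard.comp (measurable_set_iff.2 fun k => ?_)
  refine Measurable.and (measurable_mem.2 (measurable_iter T k hA)) (measurable_const.and ?_)
  refine Measurable.exists fun l => measurable_const.and (Measurable.exists fun j => ?_)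
  exact measurableSet_setOfPred.1 (measurableSet_eq_fun
    ((measurable_iter U j).comp (measurable_iter T k)) (measurable_iter T l))

/-- If the `U`-orbit of `T^{-m} x` reaches the cut or beyond, fewer than `n` steps of `U` cover a
distance at least `m`; hence the sum of `|c|` over `n` steps is at least `m`. -/
lemma orbitCrossing_zero_subset {T U : X ≃ᵐ X} {A : Set X} {c : X → ℤ} {n : ℕ} {x : X}
    (hinj : Function.Injective fun k : ℤ => iter T k x)
    (hc : ∀ (k : ℤ) (i : ℕ), U (U^[i] (iter T k x)) =
      iter T (c (U^[i] (iter T k x))) (U^[i] (iter T k x)))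
    (horb : ∀ k : ℤ, iter T k x ∈ A → (orbit U (iter T k x)).encard = n) :
    orbitCrossing T U A x 0 ⊆ (fun m : ℕ => -(m : ℤ)) ''
      {m : ℕ | (m : ℝ) ≤ ∑ i ∈ Finset.range n, |(c (U^[i] (iter T (-m) x)) : ℝ)|} := by
  rintro k ⟨hkA, hk0, l, hl, hkl⟩
  refine ⟨(-k).toNat, ?_, by show -((-k).toNat : ℤ) = k; omega⟩
  obtain ⟨i, hi, e⟩ := exists_iterate_eq_of_mem_orbit (horb k hkA) hkl
  rw [iterate_eq_iter_sum (hc k), ← iter_add] at e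
  have hs := hinj e
  have hle : -k ≤ ∑ i ∈ Finset.range n, |c (U^[i] (iter T k x))| := by
    calc -k ≤ ∑ j ∈ Finset.range i, c (U^[j] (iter T k x)) := by omega
      _ ≤ ∑ j ∈ Finset.range i, |c (U^[j] (iter T k x))| :=
        Finset.sum_le_sum fun j _ => le_abs_self _
      _ ≤ _ := Finset.sum_le_sum_of_subset_of_nonneg (Finset.range_mono hi.le)
        fun j _ _ => abs_nonneg _
  have e1 : (((-k).toNat : ℕ) : ℤ) = -k := by omega
  show (((-k).toNat : ℕ) : ℝ) ≤ _
  rw [e1, neg_neg]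
  have : (((-k).toNat : ℕ) : ℝ) = ((-k : ℤ) : ℝ) := by rw [← Int.cast_natCast, e1]
  rw [this]
  exact_mod_cast hle

open Classical in
/-- An `n`-cycle of the `L¹` full group with support `A` gives a solution `f` of
`f ∘ T = f + 1_A` with values in `ℤ / n`. -/
lemma exists_measurable_comp_eq_add_indicator [StandardBorelSpace X]
    {μ : Measure X} [IsProbabilityMeasure μ] {T : X ≃ᵐ X} (hT : MeasurePreserving T μ μ)
    (hinj : ∀ᵐ x ∂μ, Function.Injective fun k : ℤ => iter T k x) {U : X ≃ᵐ X}
    (hU : U ∈ fullGroupL1 μ T) {n : ℕ} (hn : 0 < n) (hcyc : IsNCycle μ U n) {A : Set X}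
    (hA : MeasurableSet A) (hsupp : support U =ᵐ[μ] A) :
    ∃ f : X → ℕ, Measurable f ∧
      ∀ᵐ x ∂μ, (f (T x) : ZMod n) = f x + if x ∈ A then 1 else 0 := by
  obtain ⟨hUm, c, hc, hci⟩ := hU
  refine ⟨_, measurable_ncard_orbitCrossing T U hA, ?_⟩
  have hD : Integrable (fun y => ∑ i ∈ Finset.range n, |(c (U^[i] y) : ℝ)|) μ :=
    integrable_finsetSum _ fun i _ => ((hUm.iterate i).integrable_comp_of_integrable hci).abs
  have hfin : ∀ᵐ x ∂μ, (orbitCrossing T U A x 0).Finite ∧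
      (∀ k : ℤ, iter T k x ∈ A → (orbit U (iter T k x)).encard = n) ∧
      (∀ k : ℤ, iter T k x ∈ support U ↔ iter T k x ∈ A) ∧
      (∀ (k : ℤ) (i : ℕ), U (U^[i] (iter T k x)) =
        iter T (c (U^[i] (iter T k x))) (U^[i] (iter T k x))) ∧
      Function.Injective fun k : ℤ => iter T k x := by
    filter_upwards [hinj, ae_finite_le_comp_iter hT hD fun y =>
      Finset.sum_nonneg fun i _ => abs_nonneg _, ae_forall_iter hT (ae_forall_iter hUm hc),
      ae_forall_iter hT hcyc, ae_forall_iter hT hsupp.mem_iff] with x hx hxD hxc hxn hxs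
    -- Points of `A` are moved by `U`, so their orbits are not singletons.
    have horb : ∀ k : ℤ, iter T k x ∈ A → (orbit U (iter T k x)).encard = n := fun k hk =>
      (hxn k).resolve_left fun h1 => (hxs k).2 hk (apply_eq_self_of_encard_orbit_eq_one h1)
    have hcx : ∀ (k : ℤ) (i : ℕ), U (U^[i] (iter T k x)) =
        iter T (c (U^[i] (iter T k x))) (U^[i] (iter T k x)) := fun k i => by
      have := hxc k i
      rwa [iter_natCast] at this
    exact ⟨(hxD.image _).subset (orbitCrossing_zero_subset hx hcx horb), horb, hxs, hcx, hx⟩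
  filter_upwards [hfin, hT.quasiMeasurePreserving.ae hfin] with x hx hTx
  obtain ⟨h0, horb, hs, hcx, hx⟩ := hx
  have h1 : (orbitCrossing T U A x 1).Finite := by
    rw [orbitCrossing_apply]; exact hTx.1.image _
  have hcard : (orbitCrossing T U A x 1).ncard = (orbitCrossing T U A (T x) 0).ncard := by
    rw [orbitCrossing_apply]
    exact Set.ncard_image_of_injective _ (add_left_injective 1)
  rw [← hcard]
  have key := ncard_crossing_one (r := fun k l => iter T l x ∈ orbit U (iter T k x))
    ⟨fun k => mem_orbit_self U _, fun h => orbit_symm h, fun h h' => orbit_trans h h'⟩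
    (P := {k | iter T k x ∈ A}) ?_ hn ?_ h0 h1
  · have e0 : ((0 : ℤ) ∈ {k | iter T k x ∈ A}) ↔ x ∈ A := by
      show iter T 0 x ∈ A ↔ _
      rw [iter_zero]
    simp only [e0] at key
    exact key
  · intro k l hkl
    show iter T k x ∈ A ↔ iter T l x ∈ A
    rw [← hs, ← hs]
    have : ∀ {y z : X}, z ∈ orbit U y → U y = y → U z = z := fun {y z} hz hy => by
      rw [orbit_eq_singleton hy] at hz
      rw [Set.mem_singleton_iff.1 hz, hy]
    exact not_congr ⟨this hkl, this (orbit_symm hkl)⟩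
  · intro k hk
    -- A `U`-orbit stays inside its `T`-orbit, so the injection `l ↦ T^l x` identifies the class
    -- with the whole `U`-orbit.
    have himg : (fun l : ℤ => iter T l x) '' {l | iter T l x ∈ orbit U (iter T k x)} =
        orbit U (iter T k x) := by
      ext y
      constructor
      · rintro ⟨l, hl, rfl⟩; exact hl
      · intro hy
        obtain ⟨i, _, e⟩ := exists_iterate_eq_of_mem_orbit (horb k hk) hy
        rw [iterate_eq_iter_sum (hcx k), ← iter_add] at e
        exact ⟨_, by rw [Set.mem_ofPred_eq, e]; exact hy, e⟩
    rw [← Set.ncard_image_of_injective _ hx, himg, Set.ncard, horb k hk]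
    rfl

end CrossingNumber

/-! ### The induced transformation and the splitting -/

section Induced

variable {X : Type*} [MeasurableSpace X]

/-- Poincaré recurrence for `T` and `T⁻¹`; backward returns are what makes `T_A` surjective. -/
lemma ae_recurrent {μ : Measure X} [IsProbabilityMeasure μ] {T : X ≃ᵐ X}
    (hT : MeasurePreserving T μ μ) {A : Set X} (hA : MeasurableSet A) :
    ∀ᵐ x ∂μ, x ∈ A → (∃ m : ℕ, 1 ≤ m ∧ T^[m] x ∈ A) ∧
      ∃ m : ℕ, 1 ≤ m ∧ iter T (-m) x ∈ A := by
  filter_upwards [hT.conservative.ae_mem_imp_frequently_image_mem hA.nullMeasurableSet,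
    (hT.symm T).conservative.ae_mem_imp_frequently_image_mem hA.nullMeasurableSet] with x h h' hx
  obtain ⟨m, hm, e⟩ := ((h hx).and_eventually (eventually_ge_atTop 1)).exists
  obtain ⟨m', hm', e'⟩ := ((h' hx).and_eventually (eventually_ge_atTop 1)).exists
  exact ⟨⟨m, e, hm⟩, m', e', by rwa [← iter_symm, iter_natCast]⟩

lemma returnTime_spec {T : X ≃ᵐ X} {A : Set X} {x : X} (h : ∃ m : ℕ, 1 ≤ m ∧ T^[m] x ∈ A) :
    1 ≤ returnTime T A x ∧ T^[returnTime T A x] x ∈ A :=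
  Nat.sInf_mem (s := {n : ℕ | 1 ≤ n ∧ T^[n] x ∈ A}) h

lemma iterate_notMem_of_lt_returnTime {T : X ≃ᵐ X} {A : Set X} {x : X} {m : ℕ} (h1 : 1 ≤ m)
    (hm : m < returnTime T A x) : T^[m] x ∉ A := fun h =>
  Nat.notMem_of_lt_sInf (s := {n : ℕ | 1 ≤ n ∧ T^[n] x ∈ A}) hm ⟨h1, h⟩

lemma returnTime_le {T : X ≃ᵐ X} {A : Set X} {x : X} {m : ℕ} (h1 : 1 ≤ m) (hm : T^[m] x ∈ A) :
    returnTime T A x ≤ m :=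
  Nat.sInf_le (s := {n : ℕ | 1 ≤ n ∧ T^[n] x ∈ A}) ⟨h1, hm⟩

lemma induced_of_mem {T : X ≃ᵐ X} {A : Set X} {x : X} (hx : x ∈ A) :
    induced T A x = T^[returnTime T A x] x := if_pos hx

lemma induced_of_notMem {T : X ≃ᵐ X} {A : Set X} {x : X} (hx : x ∉ A) :
    induced T A x = x := if_neg hx

lemma induced_mem {T : X ≃ᵐ X} {A : Set X} {x : X} (hx : x ∈ A)
    (h : ∃ m : ℕ, 1 ≤ m ∧ T^[m] x ∈ A) : induced T A x ∈ A := by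
  rw [induced_of_mem hx]; exact (returnTime_spec h).2

lemma iterate_mem_iff_of_invariant {T : X ≃ᵐ X} {G : Set X} (hG : ∀ x, T x ∈ G ↔ x ∈ G) (k : ℕ)
    (x : X) : T^[k] x ∈ G ↔ x ∈ G := by
  rw [← iter_natCast, mem_iter_iff_of_invariant hG]

lemma induced_mem_iff_of_invariant {T : X ≃ᵐ X} {A G : Set X} (hG : ∀ x, T x ∈ G ↔ x ∈ G) (x : X) :
    induced T A x ∈ G ↔ x ∈ G := by
  by_cases hx : x ∈ A
  · rw [induced_of_mem hx, iterate_mem_iff_of_invariant hG]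
  · rw [induced_of_notMem hx]

/-- The preimage is the most recent earlier visit to `A`: minimality of `k` forces its return time
to be exactly `k`. -/
lemma exists_induced_eq {T : X ≃ᵐ X} {A : Set X} {y : X} (hy : y ∈ A)
    (h : ∃ m : ℕ, 1 ≤ m ∧ iter T (-m) y ∈ A) : ∃ x ∈ A, induced T A x = y := by
  classical
  have hk := Nat.find_spec h
  set k := Nat.find h
  have hit : ∀ m : ℕ, T^[m] (iter T (-k) y) = iter T (-(k - m)) y := fun m => by
    rw [← iter_natCast, ← iter_add]; congr 2; ring
  have hky : T^[k] (iter T (-k) y) = y := by rw [hit]; simp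
  have hr := returnTime_spec (T := T) (A := A) (x := iter T (-k) y) ⟨k, hk.1, by rwa [hky]⟩
  have hle := returnTime_le (T := T) (A := A) (x := iter T (-k) y) hk.1 (by rwa [hky])
  have heq : returnTime T A (iter T (-k) y) = k := by
    refine eq_of_le_of_not_lt hle fun hlt => ?_
    refine Nat.find_min h (m := k - returnTime T A (iter T (-k) y)) (by omega) ⟨by omega, ?_⟩
    have := hr.2
    rw [hit] at this
    rwa [Nat.cast_sub hle]
  exact ⟨_, hk.2, by rw [induced_of_mem hk.2, heq, hky]⟩

open Classical in
-- Before its return, the orbit of `x` meets `A` only at `x`, so `f` is incremented once.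
lemma apply_induced_eq_add_one {T : X ≃ᵐ X} {A : Set X} {n : ℕ} {f : X → ℕ} {x : X}
    (hf : ∀ m : ℕ, (f (T (T^[m] x)) : ZMod n) = f (T^[m] x) + if T^[m] x ∈ A then 1 else 0)
    (hx : x ∈ A) (h : ∃ m : ℕ, 1 ≤ m ∧ T^[m] x ∈ A) :
    (f (induced T A x) : ZMod n) = f x + 1 := by
  have key : ∀ m : ℕ, m + 1 ≤ returnTime T A x → (f (T^[m + 1] x) : ZMod n) = f x + 1 := by
    intro m
    induction m with
    | zero => intro _; simpa [hx] using hf 0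
    | succ m ih =>
      intro hm
      rw [Function.iterate_succ_apply', hf, ih (by omega),
        if_neg (iterate_notMem_of_lt_returnTime (by omega) (by omega)), add_zero]
  have h1 := (returnTime_spec h).1
  have := key (returnTime T A x - 1) (by omega)
  rwa [Nat.sub_add_cancel h1, ← induced_of_mem hx] at this

open Classical in
lemma splitsAlongInduced_of_comp_eq_add_indicator {μ : Measure X} [IsProbabilityMeasure μ]
    {T : X ≃ᵐ X} (hT : MeasurePreserving T μ μ) {A : Set X} (hA : MeasurableSet A) {n : ℕ}
    (hn : 0 < n) {f : X → ℕ} (hfm : Measurable f)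
    (hf : ∀ᵐ x ∂μ, (f (T x) : ZMod n) = f x + if x ∈ A then 1 else 0) :
    SplitsAlongInduced μ T A n := by
  -- `T_A` preserves `G` in both directions, so images under it can be compared pointwise on `G`,
  -- whatever happens off `G`.
  obtain ⟨G, -, hG, hGμ, hp⟩ := exists_invariant_conull hT (hf.and (ae_recurrent hT hA))
  have hstep : ∀ x ∈ A ∩ G, induced T A x ∈ A ∩ G ∧ (f (induced T A x) : ZMod n) = f x + 1 :=
    fun x hx => ⟨⟨induced_mem hx.1 ((hp x hx.2).2 hx.1).1,
      (induced_mem_iff_of_invariant hG x).2 hx.2⟩, apply_induced_eq_add_one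
        (fun m => (hp _ ((iterate_mem_iff_of_invariant hG m x).2 hx.2)).1) hx.1
        ((hp x hx.2).2 hx.1).1⟩
  have hiter : ∀ (i : ℕ), ∀ x ∈ A ∩ G,
      (induced T A)^[i] x ∈ A ∩ G ∧ (f ((induced T A)^[i] x) : ZMod n) = f x + i := by
    intro i x hx
    induction i with
    | zero => simpa using hx
    | succ i ih =>
      rw [Function.iterate_succ_apply']
      refine ⟨(hstep _ ih.1).1, ?_⟩
      rw [(hstep _ ih.1).2, ih.2]; push_cast; ring
  have hsurj : ∀ (i : ℕ), ∀ y ∈ A ∩ G, ∃ x ∈ A ∩ G, (induced T A)^[i] x = y := by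
    intro i
    induction i with
    | zero => exact fun y hy => ⟨y, hy, rfl⟩
    | succ i ih =>
      intro y hy
      obtain ⟨z, hz, e⟩ := exists_induced_eq hy.1 ((hp y hy.2).2 hy.1).2
      have hzG : z ∈ G := by rw [← induced_mem_iff_of_invariant (A := A) hG, e]; exact hy.2
      obtain ⟨x, hx, e'⟩ := ih z ⟨hz, hzG⟩
      exact ⟨x, hx, by rw [Function.iterate_succ_apply', e', e]⟩
  have hGit : ∀ (i : ℕ) (x : X), (induced T A)^[i] x ∈ G ↔ x ∈ G := by
    intro i x
    induction i with
    | zero => rfl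
    | succ i ih => rw [Function.iterate_succ_apply', induced_mem_iff_of_invariant hG, ih]
  refine ⟨A ∩ {x | (f x : ZMod n) = 0}, hA.inter ?_, Set.inter_subset_left, ?_, ?_⟩
  · exact hfm (MeasurableSet.of_discrete (s := {m : ℕ | (m : ZMod n) = 0}))
  · intro i hi j hj hij
    refine measure_mono_null ?_ (ae_iff.1 hGμ)
    rintro z ⟨⟨x, hx, rfl⟩, y, hy, e⟩ hz
    have hxG := (hGit i x).1 hz
    have hyG := (hGit j y).1 (by rw [e]; exact hz)
    have h1 := (hiter i x ⟨hx.1, hxG⟩).2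
    have h2 := (hiter j y ⟨hy.1, hyG⟩).2
    rw [e, h1, show (f x : ZMod n) = 0 from hx.2, show (f y : ZMod n) = 0 from hy.2, zero_add,
      zero_add, ZMod.natCast_eq_natCast_iff', Nat.mod_eq_of_lt hi, Nat.mod_eq_of_lt hj] at h2
    exact hij h2
  · refine Filter.eventuallyEq_set.2 ?_
    filter_upwards [hGμ] with z hz
    simp only [Set.mem_iUnion]
    constructor
    · intro hzA
      -- Going back `f z % n` steps of `T_A` from `z` lands where `f` vanishes modulo `n`, that is,
      -- in `B`.
      obtain ⟨x, hx, e⟩ := hsurj (f z % n) z ⟨hzA, hz⟩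
      refine ⟨f z % n, Nat.mod_lt _ hn, x, ⟨hx.1, ?_⟩, e⟩
      have := (hiter (f z % n) x hx).2
      rw [e, ZMod.natCast_mod] at this
      exact left_eq_add.1 (this.trans (add_comm _ _))
    · rintro ⟨i, hi, x, hx, rfl⟩
      exact (hiter i x ⟨hx.1, (hGit i x).1 hz⟩).1.1

end Induced

/-! ### Closure properties of the `L¹` full group -/

section Closure

variable {X : Type*} [MeasurableSpace X] {μ : Measure X} {T : X ≃ᵐ X}

lemma symm_mem_fullGroupL1 {U : X ≃ᵐ X} (hU : U ∈ fullGroupL1 μ T) : U.symm ∈ fullGroupL1 μ T := by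
  obtain ⟨hm, c, hc, hi⟩ := hU
  have hs := hm.symm U
  refine ⟨hs, fun x => -c (U.symm x), ?_, ?_⟩
  · filter_upwards [hs.quasiMeasurePreserving.ae hc] with x hx
    rw [U.apply_symm_apply] at hx
    apply iter_injective T (c (U.symm x))
    rw [← hx, iter_iter_neg]
  · simpa [Function.comp_def] using (hs.integrable_comp_of_integrable hi).neg

lemma trans_mem_fullGroupL1 {U V : X ≃ᵐ X} (hU : U ∈ fullGroupL1 μ T) (hV : V ∈ fullGroupL1 μ T) :
    V.trans U ∈ fullGroupL1 μ T := by
  obtain ⟨hm, c, hc, hi⟩ := hU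
  obtain ⟨hm', c', hc', hi'⟩ := hV
  refine ⟨hm.comp hm', fun x => c (V x) + c' x, ?_, ?_⟩
  · filter_upwards [hc', hm'.quasiMeasurePreserving.ae hc] with x hx hx'
    rw [iter_add, ← hx, ← hx']; rfl
  · simpa [Function.comp_def, Pi.add_def] using (hm'.integrable_comp_of_integrable hi).add hi'

lemma exists_iterate_mem_fullGroupL1 {U : X ≃ᵐ X} (hU : U ∈ fullGroupL1 μ T) (m : ℕ) :
    ∃ W ∈ fullGroupL1 μ T, ∀ x, W x = U^[m] x := by
  induction m with
  | zero =>
    exact ⟨MeasurableEquiv.refl X, ⟨MeasurePreserving.id μ, fun _ => 0, by simp [IsCocycle],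
      by simp⟩, fun x => rfl⟩
  | succ m ih =>
    obtain ⟨W, hW, h⟩ := ih
    exact ⟨_, trans_mem_fullGroupL1 hU hW, fun x => by
      rw [Function.iterate_succ_apply', ← h]; rfl⟩

open Classical in
/-- Two elements of the `L¹` full group with the same image of `L` are glued along `L`. -/
lemma exists_piecewise_mem_fullGroupL1 {V W : X ≃ᵐ X} (hV : V ∈ fullGroupL1 μ T)
    (hW : W ∈ fullGroupL1 μ T) {L : Set X} (hL : MeasurableSet L) (hVW : V '' L = W '' L) :
    ∃ U ∈ fullGroupL1 μ T, ∀ x, U x = if x ∈ L then W x else V x := by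
  have hL' : MeasurableSet (W '' L) := W.measurableSet_image.2 hL
  have hWmem : ∀ x, W x ∈ W '' L ↔ x ∈ L := fun x => W.injective.mem_set_image
  have hVmem : ∀ x, V x ∈ W '' L ↔ x ∈ L := fun x => by
    rw [← hVW]; exact V.injective.mem_set_image
  have hWs : ∀ y, W.symm y ∈ L ↔ y ∈ W '' L := fun y => by rw [← hWmem, W.apply_symm_apply]
  have hVs : ∀ y, V.symm y ∈ L ↔ y ∈ W '' L := fun y => by rw [← hVmem, V.apply_symm_apply]
  let U : X ≃ᵐ X :=
    { toFun := fun x => if x ∈ L then W x else V x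
      invFun := fun y => if y ∈ W '' L then W.symm y else V.symm y
      left_inv := fun x => by
        by_cases h : x ∈ L
        · simp only [h, if_true, (hWmem x).2 h, W.symm_apply_apply]
        · simp only [h, if_false, mt (hVmem x).1 h, V.symm_apply_apply]
      right_inv := fun y => by
        by_cases h : y ∈ W '' L
        · simp only [h, if_true, (hWs y).2 h, W.apply_symm_apply]
        · simp only [h, if_false, mt (hVs y).1 h, V.apply_symm_apply]
      measurable_toFun := Measurable.ite hL W.measurable V.measurable
      measurable_invFun := Measurable.ite hL' W.symm.measurable V.symm.measurable }
  have hU : ∀ x, U x = if x ∈ L then W x else V x := fun x => rfl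
  obtain ⟨hVm, c, hc, hi⟩ := hV
  obtain ⟨hWm, c', hc', hi'⟩ := hW
  refine ⟨U, ⟨⟨U.measurable, Measure.ext fun E hE => ?_⟩,
    fun x => if x ∈ L then c' x else c x, ?_, ?_⟩, hU⟩
  · rw [Measure.map_apply U.measurable hE, ← measure_inter_add_sdiff _ hL]
    have e1 : U ⁻¹' E ∩ L = W ⁻¹' (E ∩ W '' L) := by
      ext x
      simp only [Set.mem_inter_iff, Set.mem_preimage, hWmem]
      exact and_congr_left fun h => by rw [hU, if_pos h]
    have e2 : U ⁻¹' E \ L = V ⁻¹' (E \ W '' L) := by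
      ext x
      simp only [Set.mem_sdiff, Set.mem_preimage, hVmem]
      exact and_congr_left fun h => by rw [hU, if_neg h]
    rw [e1, e2, hWm.measure_preimage (hE.inter hL').nullMeasurableSet,
      hVm.measure_preimage (hE.diff hL').nullMeasurableSet, measure_inter_add_sdiff _ hL']
  · filter_upwards [hc, hc'] with x hx hx'
    rw [hU]
    split_ifs <;> assumption
  · have : (fun x => (((if x ∈ L then c' x else c x : ℤ)) : ℝ)) =
        L.piecewise (fun x => (c' x : ℝ)) fun x => (c x : ℝ) := by
      ext x
      by_cases h : x ∈ L <;> simp [h]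
    rw [this]
    exact Integrable.piecewise hL hi'.integrableOn hi.integrableOn

/-- On each of the countably many pieces `{c = k}` the map is `T^k`. The inverse is treated first,
because its preimages are images under `V` of subsets of these pieces. -/
lemma measurePreserving_of_eq_iter (hT : MeasurePreserving T μ μ) {V : X ≃ᵐ X} {c : X → ℤ}
    (hc : Measurable c) (h : ∀ x, V x = iter T (c x) x) : MeasurePreserving V μ μ := by
  have : MeasurePreserving V.symm μ μ := by
    refine ⟨V.symm.measurable, Measure.ext fun E hE => ?_⟩
    have hEk : ∀ k, MeasurableSet (E ∩ c ⁻¹' {k}) := fun k =>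
      hE.inter (hc (measurableSet_singleton k))
    have e : ∀ k, V.symm ⁻¹' (E ∩ c ⁻¹' {k}) = iter T (-k) ⁻¹' (E ∩ c ⁻¹' {k}) := by
      intro k
      ext y
      constructor
      · rintro ⟨hy, hk : c _ = k⟩
        have := h (V.symm y)
        rw [V.apply_symm_apply, hk] at this
        have e' : iter T (-k) y = V.symm y := by conv_lhs => rw [this, iter_neg_iter]
        rw [Set.mem_preimage, e']
        exact ⟨hy, hk⟩
      · rintro ⟨hy, hk : c _ = k⟩
        have := h (iter T (-k) y)
        rw [hk, iter_iter_neg] at this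
        have e' : V.symm y = iter T (-k) y := by rw [← this, V.symm_apply_apply, this]
        rw [Set.mem_preimage, e']
        exact ⟨hy, hk⟩
    have hcov : E = ⋃ k, E ∩ c ⁻¹' {k} := by ext x; simp
    have hdisj : Pairwise (Function.onFun Disjoint fun k => E ∩ c ⁻¹' {k}) := by
      intro k l hkl
      refine Set.disjoint_left.2 ?_
      rintro x ⟨_, hk : c x = k⟩ ⟨_, hl : c x = l⟩
      exact hkl (hk.symm.trans hl)
    rw [Measure.map_apply V.symm.measurable hE]
    conv_lhs => rw [hcov, Set.preimage_iUnion]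
    conv_rhs => rw [hcov]
    rw [measure_iUnion hdisj hEk, measure_iUnion (fun k l hkl => (hdisj hkl).preimage _)
      fun k => V.symm.measurable (hEk k)]
    congr 1; ext k
    rw [e, (measurePreserving_iter hT (-k)).measure_preimage (hEk k).nullMeasurableSet]
  simpa using this.symm V.symm

end Closure

/-! ### Kac's estimate -/

section Kac

variable {X : Type*} [MeasurableSpace X]

lemma lt_returnTime_iff {T : X ≃ᵐ X} {A : Set X} {x : X} {m : ℕ} :
    m < returnTime T A x ↔
      (∃ j : ℕ, 1 ≤ j ∧ T^[j] x ∈ A) ∧ ∀ j : ℕ, 1 ≤ j → j ≤ m → T^[j] x ∉ A := by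
  constructor
  · intro h
    exact ⟨Nat.nonempty_of_pos_sInf (s := {n : ℕ | 1 ≤ n ∧ T^[n] x ∈ A}) (by
      change 0 < returnTime T A x; omega),
      fun j h1 hj => iterate_notMem_of_lt_returnTime h1 (by omega)⟩
  · rintro ⟨h, h'⟩
    have := returnTime_spec h
    by_contra hlt
    exact h' _ this.1 (by omega) this.2

lemma measurable_returnTime (T : X ≃ᵐ X) {A : Set X} (hA : MeasurableSet A) :
    Measurable (returnTime T A) := by
  refine measurable_of_Ioi fun m => ?_
  have : returnTime T A ⁻¹' Set.Ioi m =
      (⋃ j : ℕ, ⋃ _ : 1 ≤ j, T^[j] ⁻¹' A) ∩ ⋂ j : ℕ, ⋂ _ : 1 ≤ j, ⋂ _ : j ≤ m, (T^[j] ⁻¹' A)ᶜ := by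
    ext x
    simp only [Set.mem_preimage, Set.mem_Ioi, lt_returnTime_iff, Set.mem_inter_iff,
      Set.mem_iUnion, Set.mem_iInter, Set.mem_compl_iff, exists_prop]
  rw [this]
  have hm : ∀ j : ℕ, MeasurableSet (T^[j] ⁻¹' A) := fun j => T.measurable.iterate j hA
  exact (MeasurableSet.iUnion fun j => .iUnion fun _ => hm j).inter
    (.iInter fun j => .iInter fun _ => .iInter fun _ => (hm j).compl)

open Classical in
/-- The return time to `A` is integrable on `A`. -/
lemma integrable_returnTime {μ : Measure X} [IsProbabilityMeasure μ] {T : X ≃ᵐ X}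
    (hT : MeasurePreserving T μ μ) {A : Set X} (hA : MeasurableSet A) :
    Integrable (fun x => ((if x ∈ A then returnTime T A x else 0 : ℕ) : ℝ)) μ := by
  have hr := measurable_returnTime T hA
  have hE : ∀ m : ℕ, MeasurableSet (A ∩ {x | m < returnTime T A x}) := fun m =>
    hA.inter (hr measurableSet_Ioi)
  have hmeas : Measurable fun x => if x ∈ A then returnTime T A x else 0 :=
    Measurable.ite hA hr measurable_const
  refine ⟨(measurable_of_countable (fun m : ℕ => (m : ℝ))).comp hmeas |>.aestronglyMeasurable, ?_⟩
  -- Layer-cake formula: the return time is the sum over `m` of the indicators of `{m <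
  -- returnTime}`.
  have hsum : ∀ x, ‖((if x ∈ A then returnTime T A x else 0 : ℕ) : ℝ)‖ₑ =
      ∑' m : ℕ, (A ∩ {x | m < returnTime T A x}).indicator (1 : X → ENNReal) x := by
    intro x
    by_cases hx : x ∈ A
    · rw [if_pos hx, tsum_eq_sum (s := Finset.range (returnTime T A x))]
      · rw [Finset.sum_congr rfl fun m hm => Set.indicator_of_mem
          (show x ∈ A ∩ {x | m < returnTime T A x} from ⟨hx, Finset.mem_range.1 hm⟩) _]
        simp
      · intro m hm
        exact Set.indicator_of_notMem (fun h => hm (Finset.mem_range.2 h.2)) _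
    · simp [hx]
  -- The translates `T^m (A ∩ {m < returnTime})` are disjoint, since `m` is the time elapsed since
  -- the latest visit to `A`. Their total mass is at most `1`; ergodicity plays no role.
  have hbound : ∑' m : ℕ, μ (A ∩ {x | m < returnTime T A x}) ≤ μ Set.univ := by
    have e : ∀ m : ℕ, μ (A ∩ {x | m < returnTime T A x}) =
        μ (iter T (-m) ⁻¹' (A ∩ {x | m < returnTime T A x})) := fun m =>
      ((measurePreserving_iter hT (-m)).measure_preimage (hE m).nullMeasurableSet).symm
    simp_rw [e]
    refine tsum_measure_le_measure_univ
      (fun m => (measurable_iter T (-m) (hE m)).nullMeasurableSet) ?_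
    have key : ∀ m l : ℕ, m < l → ∀ y, iter T (-m) y ∈ A →
        ¬ l < returnTime T A (iter T (-l) y) := by
      intro m l hml y hy hl
      have : T^[l - m] (iter T (-l) y) ∈ A := by
        rw [← iter_natCast, ← iter_add, Nat.cast_sub hml.le]
        convert hy using 3; ring
      have := returnTime_le (by omega) this
      omega
    intro m l hml
    refine (Set.disjoint_left.2 ?_).aedisjoint
    rintro y ⟨hy, hy'⟩ ⟨hz, hz'⟩
    rcases lt_or_gt_of_ne hml with h | h
    · exact key m l h y hy hz'
    · exact key l m h y hz hy'
  rw [HasFiniteIntegral, lintegral_congr hsum, lintegral_tsum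
    fun m => (measurable_one.indicator (hE m)).aemeasurable]
  simp_rw [lintegral_indicator_one (hE _)]
  exact hbound.trans_lt (measure_lt_top μ _)

open Classical in
/-- If all points of `A` return to `A` in both directions, then `T_A` belongs to the `L¹` full
group. -/
lemma exists_eq_induced_mem_fullGroupL1 [StandardBorelSpace X] {μ : Measure X}
    [IsProbabilityMeasure μ] {T : X ≃ᵐ X}
    (hT : MeasurePreserving T μ μ) {A : Set X} (hA : MeasurableSet A)
    (hrec : ∀ x ∈ A, (∃ m : ℕ, 1 ≤ m ∧ T^[m] x ∈ A) ∧ ∃ m : ℕ, 1 ≤ m ∧ iter T (-m) x ∈ A) :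
    ∃ V ∈ fullGroupL1 μ T, ∀ x, V x = induced T A x := by
  have hcm : Measurable fun x => if x ∈ A then returnTime T A x else 0 :=
    Measurable.ite hA (measurable_returnTime T hA) measurable_const
  have heq : ∀ x, induced T A x = T^[if x ∈ A then returnTime T A x else 0] x := fun x => by
    by_cases h : x ∈ A
    · rw [induced_of_mem h, if_pos h]
    · rw [induced_of_notMem h, if_neg h]; rfl
  have hmeas : Measurable (induced T A) := by
    have h2 : Measurable fun p : ℕ × X => T^[p.1] p.2 :=
      measurable_from_prod_countable_right fun k => T.measurable.iterate k
    have : induced T A = fun x => (fun p : ℕ × X => T^[p.1] p.2)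
        ((if x ∈ A then returnTime T A x else 0), x) := funext heq
    rw [this]
    exact h2.comp (hcm.prodMk measurable_id)
  -- If the images agree and `x ≠ y`, then `x` is a point of `A` on the orbit of `y` strictly before
  -- the return of `y`.
  have hle : ∀ x ∈ A, ∀ y ∈ A, returnTime T A x ≤ returnTime T A y →
      T^[returnTime T A x] x = T^[returnTime T A y] y → x = y := by
    intro x hx y hy hxy e
    have e' : x = T^[returnTime T A y - returnTime T A x] y := by
      apply T.injective.iterate (returnTime T A x)
      rw [e, ← Function.iterate_add_apply]; congr 1; omega
    have h1 := (returnTime_spec (hrec x hx).1).1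
    by_contra hne
    have h0 : returnTime T A y - returnTime T A x ≠ 0 := fun h => hne (by rw [e', h]; rfl)
    exact iterate_notMem_of_lt_returnTime (by omega) (by omega) (e' ▸ hx)
  have hinj : Function.Injective (induced T A) := by
    intro x y e
    by_cases hx : x ∈ A <;> by_cases hy : y ∈ A
    · rw [induced_of_mem hx, induced_of_mem hy] at e
      rcases le_total (returnTime T A x) (returnTime T A y) with h | h
      · exact hle x hx y hy h e
      · exact (hle y hy x hx h e.symm).symm
    · have := induced_mem hx (hrec x hx).1
      rw [e, induced_of_notMem hy] at this
      exact absurd this hy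
    · have := induced_mem hy (hrec y hy).1
      rw [← e, induced_of_notMem hx] at this
      exact absurd this hx
    · rwa [induced_of_notMem hx, induced_of_notMem hy] at e
  have hsurj : Function.Surjective (induced T A) := by
    intro y
    by_cases hy : y ∈ A
    · obtain ⟨x, _, h⟩ := exists_induced_eq hy (hrec y hy).2
      exact ⟨x, h⟩
    · exact ⟨y, induced_of_notMem hy⟩
  -- Lusin–Souslin: an injective Borel map sends Borel sets to Borel sets, so the inverse is Borel.
  have hemb := hmeas.measurableEmbedding hinj
  let V : X ≃ᵐ X :=
    { Equiv.ofBijective _ ⟨hinj, hsurj⟩ with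
      measurable_toFun := hmeas
      measurable_invFun := by
        intro E hE
        have : (Equiv.ofBijective _ ⟨hinj, hsurj⟩).symm ⁻¹' E = induced T A '' E :=
          ((Equiv.ofBijective _ ⟨hinj, hsurj⟩).image_eq_preimage_symm E).symm
        exact this ▸ hemb.measurableSet_image.2 hE }
  have hV : ∀ x, V x = induced T A x := fun x => rfl
  have hVc : ∀ x, V x = iter T ((if x ∈ A then returnTime T A x else 0 : ℕ) : ℤ) x := fun x => by
    rw [hV, heq, iter_natCast]
  refine ⟨V, ⟨measurePreserving_of_eq_iter hT
    ((measurable_of_countable (fun m : ℕ => (m : ℤ))).comp hcm) hVc, _,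
    Eventually.of_forall hVc, ?_⟩, hV⟩
  simpa using integrable_returnTime hT hA

end Kac

/-! ### From towers to cycles -/

section Towers

variable {X : Type*} [MeasurableSpace X]

open Classical in
/-- If `A` is the disjoint union of `B, V B, …, V^(n-1) B`, then closing up the tower gives an
`n`-cycle supported on `A`. -/
lemma exists_cycle_of_tower {μ : Measure X} {T V : X ≃ᵐ X} (hV : V ∈ fullGroupL1 μ T) {A B : Set X}
    (hB : MeasurableSet B) {n : ℕ} (hn : 2 ≤ n) (hBA : B ⊆ A) (hVA : ∀ x, V x ∈ A ↔ x ∈ A)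
    (hoff : ∀ x ∉ A, V x = x) (hcov : ∀ y ∈ A, ∃ i < n, ∃ b ∈ B, V^[i] b = y)
    (hdisj : ∀ b ∈ B, ∀ b' ∈ B, ∀ i < n, ∀ j < n, V^[i] b = V^[j] b' → i = j) :
    ∃ U ∈ fullGroupL1 μ T,
      (∀ x, (orbit U x).encard = 1 ∨ (orbit U x).encard = (n : ℕ∞)) ∧ support U = A := by
  -- `W '' B` is the top level. The cycle will be `V` below it and `W⁻¹` on it.
  obtain ⟨W, hW, hWV⟩ := exists_iterate_mem_fullGroupL1 hV (n - 1)
  have hLm : MeasurableSet (W '' B) := W.measurableSet_image.2 hB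
  have hWL : W.symm '' (W '' B) = B := by
    rw [← Set.image_comp]; simp
  have hiterA : ∀ (i : ℕ) (x : X), V^[i] x ∈ A ↔ x ∈ A := fun i x => by
    induction i with
    | zero => rfl
    | succ i ih => rw [Function.iterate_succ_apply', hVA, ih]
  -- The gluing condition: `V` maps the top level onto `B`, because landing in level `i + 1` would
  -- put the top in level `i < n - 1`.
  have hVL : V '' (W '' B) = W.symm '' (W '' B) := by
    rw [hWL]
    ext y
    constructor
    · rintro ⟨_, ⟨b, hb, rfl⟩, rfl⟩
      obtain ⟨i, hi, b', hb', e⟩ := hcov _ ((hVA _).2 (by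
        rw [hWV, hiterA]; exact hBA hb) : V (W b) ∈ A)
      rcases i with _ | i
      · rw [← e]; exact hb'
      · rw [Function.iterate_succ_apply'] at e
        have e' := V.injective e
        rw [hWV] at e'
        have := hdisj b' hb' b hb i (by omega) (n - 1) (by omega) e'
        omega
    · intro hy
      obtain ⟨i, hi, b, hb, e⟩ := hcov (V.symm y) (by
        rw [← hVA, V.apply_symm_apply]; exact hBA hy)
      have e' : V^[i + 1] b = y := by
        rw [Function.iterate_succ_apply', e, V.apply_symm_apply]
      have hi' : i = n - 1 := by
        by_contra hne
        have := hdisj b hb y hy (i + 1) (by omega) 0 (by omega) e'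
        omega
      refine ⟨W b, ⟨b, hb, rfl⟩, ?_⟩
      rw [hWV, ← hi', ← Function.iterate_succ_apply' V]; exact e'
  obtain ⟨U, hU, hUe⟩ := exists_piecewise_mem_fullGroupL1 hV (symm_mem_fullGroupL1 hW) hLm hVL
  have hup : ∀ b ∈ B, ∀ i, i < n → U^[i] b = V^[i] b := by
    intro b hb i hi
    induction i with
    | zero => rfl
    | succ i ih =>
      rw [Function.iterate_succ_apply', ih (by omega), hUe, if_neg, Function.iterate_succ_apply']
      rintro ⟨b', hb', e⟩
      rw [hWV] at e
      have := hdisj b' hb' b hb (n - 1) (by omega) i (by omega) e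
      omega
  have hper : ∀ b ∈ B, U^[n] b = b := by
    intro b hb
    have : U^[n] b = U (U^[n - 1] b) := by
      rw [← Function.iterate_succ_apply' U]; congr 2; omega
    rw [this, hup b hb _ (by omega), ← hWV, hUe, if_pos ⟨b, hb, rfl⟩, W.symm_apply_apply]
  have horbB : ∀ b ∈ B, (orbit U b).encard = (n : ℕ∞) := by
    intro b hb
    have : orbit U b = (fun i => V^[i] b) '' (Finset.range n : Set ℕ) := by
      ext y
      constructor
      · intro hy
        obtain ⟨i, hi, e⟩ := exists_iterate_eq_of_mem_orbit_of_iterate_eq (by omega) (hper b hb) hy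
        exact ⟨i, by simpa using hi, by rw [← e, hup b hb i hi]⟩
      · rintro ⟨i, hi, rfl⟩
        exact ⟨i, by
          simp only [iter_natCast]
          exact hup b hb i (by simpa using hi)⟩
    rw [this, Set.InjOn.encard_image, Set.encard_coe_eq_coe_finsetCard, Finset.card_range]
    intro i hi j hj e
    exact hdisj b hb b hb i (by simpa using hi) j (by simpa using hj) e
  have horbA : ∀ x ∈ A, (orbit U x).encard = (n : ℕ∞) := by
    intro x hx
    obtain ⟨i, hi, b, hb, rfl⟩ := hcov x hx
    rw [orbit_eq_of_mem (x := b) ⟨i, by simp only [iter_natCast]; exact hup b hb i hi⟩, horbB b hb]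
  have hfix : ∀ x ∉ A, U x = x := by
    intro x hx
    rw [hUe, if_neg, hoff x hx]
    rintro ⟨b, hb, rfl⟩
    exact hx (by rw [hWV, hiterA]; exact hBA hb)
  refine ⟨U, hU, fun x => ?_, ?_⟩
  · by_cases hx : x ∈ A
    · exact Or.inr (horbA x hx)
    · left; rw [orbit_eq_singleton (hfix x hx), Set.encard_singleton]
  · ext x
    constructor
    · intro hx
      by_contra hxA
      exact hx (hfix x hxA)
    · intro hx hfx
      have := horbA x hx
      rw [orbit_eq_singleton hfx, Set.encard_singleton] at this
      have : (1 : ℕ) = n := by exact_mod_cast this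
      omega

/-- Restricting to an invariant conull set turns every almost sure hypothesis into a pointwise one,
as `exists_cycle_of_tower` requires. -/
lemma exists_cycle_of_splitsAlongInduced [StandardBorelSpace X] {μ : Measure X}
    [IsProbabilityMeasure μ] {T : X ≃ᵐ X} (hT : MeasurePreserving T μ μ) {A : Set X}
    (hA : MeasurableSet A) {n : ℕ} (hn : 2 ≤ n) (h : SplitsAlongInduced μ T A n) :
    ∃ U ∈ fullGroupL1 μ T, IsNCycle μ U n ∧ support U =ᵐ[μ] A := by
  obtain ⟨B, hB, hBA, hdisj, hcov⟩ := h
  have hd : ∀ᵐ x ∂μ, ∀ i : ℕ, ∀ j : ℕ, i < n → j < n → i ≠ j →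
      ¬ (x ∈ (induced T A)^[i] '' B ∧ x ∈ (induced T A)^[j] '' B) := by
    refine ae_all_iff.2 fun i => ae_all_iff.2 fun j => ?_
    by_cases hij : i < n ∧ j < n ∧ i ≠ j
    · filter_upwards [measure_eq_zero_iff_ae_notMem.1 (hdisj i hij.1 j hij.2.1 hij.2.2)]
        with x hx _ _ _ using hx
    · exact Eventually.of_forall fun x h1 h2 h3 => absurd ⟨h1, h2, h3⟩ hij
  obtain ⟨G, hGm, hG, hGμ, hp⟩ := exists_invariant_conull hT
    ((ae_recurrent hT hA).and (hd.and hcov.mem_iff))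
  have hmem : ∀ x ∈ G, ∀ k : ℤ, iter T k x ∈ A ∩ G ↔ iter T k x ∈ A := fun x hx k =>
    and_iff_left ((mem_iter_iff_of_invariant hG k x).2 hx)
  have hmem' : ∀ x ∈ G, ∀ k : ℕ, T^[k] x ∈ A ∩ G ↔ T^[k] x ∈ A := fun x hx k => by
    rw [← iter_natCast, hmem x hx]
  have hrec : ∀ x ∈ A ∩ G, (∃ m : ℕ, 1 ≤ m ∧ T^[m] x ∈ A ∩ G) ∧
      ∃ m : ℕ, 1 ≤ m ∧ iter T (-m) x ∈ A ∩ G := by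
    intro x hx
    simp only [hmem' x hx.2, hmem x hx.2]
    exact (hp x hx.2).1 hx.1
  obtain ⟨V, hV, hVe⟩ := exists_eq_induced_mem_fullGroupL1 hT (hA.inter hGm) hrec
  -- Orbits of points of `G` stay in `G`, so return times to `A ∩ G` and to `A` agree there.
  have hVG : ∀ x ∈ G, V x = induced T A x := by
    intro x hx
    by_cases hxA : x ∈ A
    · rw [hVe, induced_of_mem (show x ∈ A ∩ G from ⟨hxA, hx⟩), induced_of_mem hxA, returnTime, returnTime]
      simp only [hmem' x hx]
    · rw [hVe, induced_of_notMem fun h => hxA h.1, induced_of_notMem hxA]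
  have hVmemG : ∀ x, V x ∈ G ↔ x ∈ G := fun x => by rw [hVe, induced_mem_iff_of_invariant hG]
  have hoff : ∀ x ∉ A ∩ G, V x = x := fun x hx => by rw [hVe, induced_of_notMem hx]
  have hVA : ∀ x, V x ∈ A ∩ G ↔ x ∈ A ∩ G := fun x => by
    by_cases hx : x ∈ A ∩ G
    · exact iff_of_true (by rw [hVe]; exact induced_mem hx (hrec x hx).1) hx
    · rw [hoff x hx]
  have hViter : ∀ (i : ℕ), ∀ x, (x ∈ G → V^[i] x = (induced T A)^[i] x) ∧
      (V^[i] x ∈ G ↔ x ∈ G) ∧ ((induced T A)^[i] x ∈ G ↔ x ∈ G) := by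
    intro i x
    induction i with
    | zero => simp
    | succ i ih =>
      simp only [Function.iterate_succ_apply', hVmemG, induced_mem_iff_of_invariant hG, ih.2.1,
        ih.2.2, and_self, and_true]
      intro hx
      rw [hVG _ (ih.2.1.2 hx), ih.1 hx]
  have hcover : ∀ y ∈ A ∩ G, ∃ i < n, ∃ b ∈ B ∩ G, V^[i] b = y := by
    intro y hy
    have := (hp y hy.2).2.2.1 hy.1
    simp only [Set.mem_iUnion] at this
    obtain ⟨i, hi, b, hb, e⟩ := this
    have hbG : b ∈ G := (hViter i b).2.2.1 (by rw [e]; exact hy.2)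
    exact ⟨i, hi, b, ⟨hb, hbG⟩, by rw [(hViter i b).1 hbG, e]⟩
  have hdisj' : ∀ b ∈ B ∩ G, ∀ b' ∈ B ∩ G, ∀ i < n, ∀ j < n, V^[i] b = V^[j] b' → i = j := by
    intro b hb b' hb' i hi j hj e
    by_contra hij
    refine (hp (V^[i] b) ((hViter i b).2.1.2 hb.2)).2.1 i j hi hj hij ⟨⟨b, hb.1, ?_⟩, b', hb'.1, ?_⟩
    · rw [(hViter i b).1 hb.2]
    · rw [e, (hViter j b').1 hb'.2]
  obtain ⟨U, hU, hcyc, hsupp⟩ := exists_cycle_of_tower hV (hB.inter hGm) hn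
    (Set.inter_subset_inter_left G hBA) hVA hoff hcover hdisj'
  refine ⟨U, hU, Eventually.of_forall hcyc, ?_⟩
  rw [hsupp]
  refine Filter.eventuallyEq_set.2 ?_
  filter_upwards [hGμ] with x hx using and_iff_left hx

end Towers

/-! ### Weak mixing excludes cyclic factors -/

section WeakMixing

variable {X : Type*} [MeasurableSpace X] {μ : Measure X} [IsProbabilityMeasure μ] {T : X ≃ᵐ X}

lemma le_average {a : ℕ → ℝ} {δ : ℝ} (h : ∀ k, δ ≤ a k) {N : ℕ} (hN : 1 ≤ N) :
    δ ≤ (N : ℝ)⁻¹ * ∑ k ∈ Finset.range N, a k := by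
  have hN' : (0 : ℝ) < N := by exact_mod_cast hN
  rw [inv_mul_eq_div, le_div_iff₀ hN']
  calc δ * N = ∑ k ∈ Finset.range N, δ := by simp [mul_comm]
    _ ≤ _ := Finset.sum_le_sum fun k _ => h k

lemma nonpos_of_tendsto_average {a : ℕ → ℝ} {δ : ℝ} (h : ∀ k, δ ≤ a k)
    (ha : Tendsto (fun N : ℕ => (N : ℝ)⁻¹ * ∑ k ∈ Finset.range N, a k) atTop (𝓝 0)) : δ ≤ 0 :=
  ge_of_tendsto ha ((eventually_ge_atTop 1).mono fun _ hN => le_average h hN)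

/-- For invariant `s` every averaged term is `|μ(s) - μ(s)²|`, which must therefore vanish. -/
lemma IsWeaklyMixing.ergodic (hT : MeasurePreserving T μ μ) (hw : IsWeaklyMixing μ T) :
    Ergodic T μ := by
  refine ⟨hT, ⟨fun {s} hs hinv => ?_⟩⟩
  have hk : ∀ k : ℕ, T^[k] ⁻¹' s = s := fun k => by
    induction k with
    | zero => rfl
    | succ k ih => rw [Function.iterate_succ, Set.preimage_comp, ih, hinv]
  have h0 : |μ.real s - μ.real s * μ.real s| ≤ 0 :=
    nonpos_of_tendsto_average (fun k => by rw [hk, Set.inter_self]) (hw s s hs hs)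
  have h1 : μ.real s * (1 - μ.real s) = 0 := by
    have := abs_nonpos_iff.1 h0
    linear_combination this
  rw [Filter.eventuallyConst_set']
  rcases mul_eq_zero.1 h1 with h | h
  · left; exact ae_eq_empty.2 ((measureReal_eq_zero_iff (measure_ne_top μ s)).1 h)
  · right
    rw [ae_eq_univ, prob_compl_eq_zero_iff hs]
    have : μ.real s = 1 := by linarith
    rwa [Measure.real, ENNReal.toReal_eq_one_iff] at this

/-- A weakly mixing bijection has no nontrivial finite cyclic factor. -/
lemma IsWeaklyMixing.not_comp_eq_add_one (hT : MeasurePreserving T μ μ) (hw : IsWeaklyMixing μ T)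
    {n : ℕ} (hn : 2 ≤ n) {f : X → ℕ} (hf : Measurable f)
    (h : ∀ᵐ x ∂μ, (f (T x) : ZMod n) = f x + 1) : False := by
  have : Fact (1 < n) := ⟨hn⟩
  have : NeZero n := ⟨by omega⟩
  have hiter : ∀ᵐ x ∂μ, ∀ k : ℕ, (f (T^[k] x) : ZMod n) = f x + k := by
    filter_upwards [ae_forall_iter hT h] with x hx k
    induction k with
    | zero => simp
    | succ k ih =>
      have := hx k
      rw [iter_natCast] at this
      rw [Function.iterate_succ_apply', this, ih]; push_cast; ring
  set B : Set X := {x | (f x : ZMod n) = 0} with hBdef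
  have hB : MeasurableSet B := hf (MeasurableSet.of_discrete (s := {m : ℕ | (m : ZMod n) = 0}))
  have hpos : 0 < μ.real B := by
    refine lt_of_le_of_ne measureReal_nonneg fun h0 => ?_
    have hz : ∀ᵐ x ∂μ, x ∉ B :=
      measure_eq_zero_iff_ae_notMem.1 ((measureReal_eq_zero_iff (measure_ne_top μ B)).1 h0.symm)
    obtain ⟨x, hx, hx'⟩ := ((ae_forall_iter hT hz).and hiter).exists
    -- Every generic orbit visits `B`, after `-f x` steps modulo `n`.
    refine hx ((-(f x : ZMod n)).val : ℕ) ?_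
    rw [iter_natCast, hBdef, Set.mem_ofPred_eq, hx', ZMod.natCast_zmod_val, add_neg_cancel]
  have hlt : μ.real B < 1 := by
    refine lt_of_le_of_ne measureReal_le_one fun h1 => ?_
    have h1' : ∀ᵐ x ∂μ, x ∈ B := by
      rw [Measure.real, ENNReal.toReal_eq_one_iff] at h1
      exact (mem_ae_iff_prob_eq_one hB).2 h1
    obtain ⟨x, ⟨hx, hx'⟩, hx1⟩ := ((h1'.and (hT.quasiMeasurePreserving.ae h1')).and h).exists
    rw [show (f x : ZMod n) = 0 from hx, show (f (T x) : ZMod n) = 0 from hx', zero_add] at hx1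
    exact zero_ne_one hx1
  -- `μ(T⁻ᵏ B ∩ B)` is `μ(B)` if `n` divides `k` and `0` otherwise, so it stays away from `μ(B)²` by
  -- a fixed amount.
  have hle : ∀ k, min (μ.real B - μ.real B * μ.real B) (μ.real B * μ.real B) ≤
      |μ.real (T^[k] ⁻¹' B ∩ B) - μ.real B * μ.real B| := by
    intro k
    by_cases hk : (k : ZMod n) = 0
    · have : μ.real (T^[k] ⁻¹' B ∩ B) = μ.real B := by
        refine measureReal_congr (Filter.eventuallyEq_set.2 ?_)
        filter_upwards [hiter] with x hx
        refine and_iff_right_of_imp fun hxB => ?_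
        rw [Set.mem_preimage, hBdef, Set.mem_ofPred_eq, hx, hk, add_zero]
        exact hxB
      rw [this]
      exact (min_le_left _ _).trans (le_abs_self _)
    · have : μ.real (T^[k] ⁻¹' B ∩ B) = 0 := by
        refine (measureReal_eq_zero_iff (measure_ne_top μ _)).2 (measure_eq_zero_iff_ae_notMem.2 ?_)
        filter_upwards [hiter] with x hx hxB
        have h1 : (f (T^[k] x) : ZMod n) = 0 := hxB.1
        rw [hx, show (f x : ZMod n) = 0 from hxB.2, zero_add] at h1
        exact hk h1
      rw [this, zero_sub, abs_neg]
      exact (min_le_right _ _).trans (le_abs_self _)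
  have := nonpos_of_tendsto_average hle (hw B B hB hB)
  have h1 : 0 < μ.real B - μ.real B * μ.real B := by nlinarith
  have h2 : 0 < μ.real B * μ.real B := mul_pos hpos hpos
  exact absurd this (not_le.2 (lt_min h1 h2))

end WeakMixing

end L1FullGroup

theorem mainTheorem10 {X : Type*} [MeasurableSpace X] [StandardBorelSpace X]
    (μ : Measure X) [IsProbabilityMeasure μ] [NullSingletonClass μ]
    (T : X ≃ᵐ X) (hT : MeasurePreserving T μ μ) :
    (Ergodic T μ → ∀ A : Set X, MeasurableSet A → ∀ n : ℕ, 2 ≤ n →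
      ((∃ U ∈ L1FullGroup.fullGroupL1 μ T,
          L1FullGroup.IsNCycle μ U n ∧ L1FullGroup.support U =ᵐ[μ] A) ↔
        L1FullGroup.SplitsAlongInduced μ T A n)) ∧
    (L1FullGroup.IsWeaklyMixing μ T → ∀ n : ℕ,
      ¬ ∃ U ∈ L1FullGroup.fullGroupL1 μ T,
          L1FullGroup.IsNCycle μ U n ∧ L1FullGroup.support U =ᵐ[μ] Set.univ) := by
  refine ⟨fun hE A hA n hn => ⟨?_, L1FullGroup.exists_cycle_of_splitsAlongInduced hT hA hn⟩, ?_⟩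
  · rintro ⟨U, hU, hcyc, hsupp⟩
    obtain ⟨f, hfm, hf⟩ := L1FullGroup.exists_measurable_comp_eq_add_indicator hT
      (L1FullGroup.ae_injective_iter hE) hU (by omega) hcyc hA hsupp
    exact L1FullGroup.splitsAlongInduced_of_comp_eq_add_indicator hT hA (by omega) hfm hf
  · rintro hw n ⟨U, hU, hcyc, hsupp⟩
    by_cases hn : 2 ≤ n
    · obtain ⟨f, hfm, hf⟩ := L1FullGroup.exists_measurable_comp_eq_add_indicator hT
        (L1FullGroup.ae_injective_iter (hw.ergodic hT)) hU (by omega) hcyc .univ hsupp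
      simp only [Set.mem_univ, if_true] at hf
      exact hw.not_comp_eq_add_one hT hn hfm hf
    -- For `n ≤ 1` almost every orbit would be a singleton (no orbit is empty), although almost
    -- every point is moved.
    · obtain ⟨x, hx, hxs⟩ := (Filter.Eventually.and hcyc hsupp.mem_iff).exists
      refine hxs.2 (Set.mem_univ x) (L1FullGroup.apply_eq_self_of_encard_orbit_eq_one ?_)
      rcases hx with hx | hx
      · exact hx
      · obtain rfl | rfl : n = 0 ∨ n = 1 := by omega
        · rw [Nat.cast_zero, Set.encard_eq_zero] at hx
          exact absurd (L1FullGroup.mem_orbit_self U x) (by rw [hx]; exact Set.notMem_empty x)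
        · simpa using hx
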